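/- **Setting.** Let $N\ge 3$, let $\Omega\subset\mathbb R^N$ be a bounded domain with smooth boundary, let $p,q>1$, let $h,k\in L^2(\Omega)$, and let $r$ satisfy $$N\Big[\tfrac12-\tfrac1{q+1}\Big]<r<2-N\Big[\tfrac12-\tfrac1{p+1}\Big]$$ (so $0<r<2$, and $\frac1{p+1}+\frac1{q+1}>\frac{N-2}N$). Let $\varphi_1>0,\varphi_2,\varphi_3,\dots$ be a complete $L^2(\Omega)$-orthonormal system of eigenfunctions of $-\Delta$ in $H^1_0(\Omega)$, with positive eigenvalues $\lambda_1\le\lambda_2\le\cdots$ counted with multiplicity. For $s\ge0$ let $\Theta^s=\{u=\sum\xi_j\varphi_j\in L^2(\Omega):\|u\|_{\Theta^s}^2=\sum\lambda_j^s\xi_j^2<\infty\}$, let $(-\Delta)^{s}\varphi_j=\lambda_j^{s}\varphi_j$ for $s\in\mathbb R$, and let $E^r=\Theta^r\times\Theta^{2-r}$ with the product Hilbert norm $\|\cdot\|$; then $E^r\subset L^{q+1}(\Omega)\times L^{p+1}(\Omega)$. For $\mathbf u=(u,v)=(\sum\xi_j\varphi_j,\sum\eta_j\varphi_j)\in E^r$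 put $$\mathcal A(\mathbf u)=\sum_j\lambda_j\xi_j\eta_j,\quad S(\mathbf u)=\tfrac1{q+1}\int_\Omega|u|^{q+1}+\tfrac1{p+1}\int_\Omega|v|^{p+1},\quad I(\mathbf u)=\mathcal A(\mathbf u)-S(\mathbf u)-\int_\Omega ku-\int_\Omega hv .$$ Let $A>0$, let $\chi:\mathbb R\to\mathbb R$ be smooth with $\chi=1$ on $(-\infty,1]$, $\chi=0$ on $[2,\infty)$ and $-2<\chi'<0$ on $(1,2)$, and define $$J(\mathbf u)=\mathcal A(\mathbf u)-S(\mathbf u)-\psi(\mathbf u)\Big(\int_\Omega ku+\int_\Omega hv\Big),\qquad \psi(\mathbf u)=\chi\Big(\frac{S(\mathbf u)}{2A\sqrt{I(\mathbf u)^2+1}}\Big).$$ Let $\mathbf e_j^\pm=\frac1{\sqrt2}(\lambda_j^{-r/2}\varphi_j,\pm\lambda_j^{r/2-1}\varphi_j)$, $E^\pm=\{(u,\pm(-\Delta)^{r-1}u):u\in\Theta^r\}$, $X^k=E^-\oplus\langle\mathbf e_1^+,\dots,\mathbf e_k^+\rangle$ and $X_n=\langle\mathbf e_1^-,\dots,\mathbf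 e_n^-\rangle\oplus E^+$. Let $0<R_0\le R_1\le R_2\le\cdots$ be such that $J(\mathbf u)\le0$ for every $\mathbf u\in X^k$ with $\|\mathbf u\|>R_k$. Put $B_k^n=\{\mathbf u\in X^k\cap X_n:\|\mathbf u\|\le R_k\}$, with boundary $\partial B_k^n=\{\mathbf u\in B_k^n:\|\mathbf u\|=R_k\}$, and $$U_k^n=\{\mathbf u=t\,\mathbf e_{k+1}^++\mathbf w:\ t\in[0,R_{k+1}],\ \mathbf w\in B_{k+1}^n\cap X^k,\ \|\mathbf u\|\le R_{k+1}\}.$$ Let $\Gamma_k^n$ be the set of odd continuous maps $B_k^n\to X_n$ that are the identity on $\partial B_k^n$. Let $\Lambda_k^n$ be the set of continuous maps $H:U_k^n\to X_n$ with $H|_{B_k^n}\in\Gamma_k^n$ and $H(\mathbf u)=\mathbf u$ for all $\mathbf u\in U_k^n$ such that either $\|\mathbf u\|=R_{k+1}$, or $\mathbf u\in X^k$ and $R_k<\|\mathbf u\|\le R_{k+1}$. Define $$c_k^n=\inf_{h\in\Gamma_k^n}\ \sup_{\mathbf u\in B_k^n}J(h(\mathbf u)),\qquad d_k^n=\inf_{H\in\Lambda_k^n}\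 \sup_{\mathbf u\in U_k^n}J(H(\mathbf u)).$$ **Proposition.** Let $k_1\in\mathbb N$, and let $c_k,d_k\in\mathbb R$ ($k\ge k_1$) be the limits $c_k=\lim_{n}c_k^{n}$ and $d_k=\lim_{n}d_k^{n}$, both taken along one strictly increasing sequence of indices $n$ that does not depend on $k$. If $c_k=d_k$ for all $k\ge k_1$, then there exist constants $\alpha_1,\alpha_2>0$ and $k_2\ge k_1$ such that $$c_k\le\alpha_1k^{\frac{q+1}q}+\alpha_2k^{\frac{p+1}p}\qquad\text{for all }k\ge k_2 .$$ -/

import Mathlib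

open MeasureTheory Filter Topology Set
open scoped ENNReal ContDiff

noncomputable section

/-- `Ω` is a bounded domain (nonempty, open, connected) of `ℝ^N` with smooth boundary: near each
boundary point it is the sublevel set `{ρ < 0}` of a smooth function with nonzero differential. -/
structure IsSmoothBoundedDomain {N : ℕ} (Ω : Set (EuclideanSpace ℝ (Fin N))) : Prop where
  isOpen : IsOpen Ω
  isConnected : IsConnected Ω
  isBounded : Bornology.IsBounded Ω
  smooth_boundary : ∀ x ∈ frontier Ω, ∃ V : Set (EuclideanSpace ℝ (Fin N)), IsOpen V ∧ x ∈ V ∧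
    ∃ ρ : EuclideanSpace ℝ (Fin N) → ℝ, ContDiff ℝ ∞ ρ ∧ fderiv ℝ ρ x ≠ 0 ∧
      Ω ∩ V = {y | ρ y < 0} ∩ V

/-- Test functions, i.e. elements of `C_c^∞(Ω)`. -/
def IsTestFunction {N : ℕ} (Ω : Set (EuclideanSpace ℝ (Fin N)))
    (f : EuclideanSpace ℝ (Fin N) → ℝ) : Prop :=
  ContDiff ℝ ∞ f ∧ HasCompactSupport f ∧ tsupport f ⊆ Ω

/-- `u ∈ H^1_0(Ω)` with weak gradient `g`: the pair `(u, g)` is the limit in `L^2(Ω)` of pairs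
`(f, ∇ f)` with `f ∈ C_c^∞(Ω)`. -/
def HasH10Gradient {N : ℕ} (Ω : Set (EuclideanSpace ℝ (Fin N)))
    (u : EuclideanSpace ℝ (Fin N) → ℝ)
    (g : EuclideanSpace ℝ (Fin N) → EuclideanSpace ℝ (Fin N)) : Prop :=
  MemLp u 2 (volume.restrict Ω) ∧ MemLp g 2 (volume.restrict Ω) ∧
    ∃ f : ℕ → EuclideanSpace ℝ (Fin N) → ℝ, (∀ m, IsTestFunction Ω (f m)) ∧
      Tendsto (fun m => eLpNorm (fun x => u x - f m x) 2 (volume.restrict Ω)) atTop (𝓝 0) ∧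
      Tendsto (fun m => eLpNorm (fun x => g x - gradient (f m) x) 2 (volume.restrict Ω))
        atTop (𝓝 0)

/-- `u ∈ H^1_0(Ω)` solves `-Δ u = μ u` in `Ω` in the weak sense. -/
def IsDirichletEigenfunction {N : ℕ} (Ω : Set (EuclideanSpace ℝ (Fin N))) (μ : ℝ)
    (u : EuclideanSpace ℝ (Fin N) → ℝ) : Prop :=
  ∃ g : EuclideanSpace ℝ (Fin N) → EuclideanSpace ℝ (Fin N), HasH10Gradient Ω u g ∧
    ∀ f : EuclideanSpace ℝ (Fin N) → ℝ, IsTestFunction Ω f →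
      ∫ x in Ω, inner ℝ (g x) (gradient f x) = μ * ∫ x in Ω, u x * f x

/-- A complete `L^2(Ω)`-orthonormal system of Dirichlet eigenfunctions `φ_1 > 0, φ_2, φ_3, …` of
`-Δ`, with positive eigenvalues `λ_1 ≤ λ_2 ≤ …` counted with multiplicity. The enumeration starts
at `0` here: `basis j` is `φ_{j+1}` and `eigenvalue j` is `λ_{j+1}`. -/
structure DirichletEigensystem {N : ℕ} (Ω : Set (EuclideanSpace ℝ (Fin N))) where
  basis : HilbertBasis ℕ ℝ (Lp ℝ 2 (volume.restrict Ω))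
  eigenvalue : ℕ → ℝ
  eigenvalue_pos : ∀ j, 0 < eigenvalue j
  eigenvalue_mono : Monotone eigenvalue
  isEigenfunction : ∀ j, IsDirichletEigenfunction Ω (eigenvalue j) (basis j)
  first_pos : ∀ᵐ x ∂(volume.restrict Ω), 0 < basis 0 x

section Spaces

variable {N : ℕ} {Ω : Set (EuclideanSpace ℝ (Fin N))}

/-- The Fourier coefficient `∫_Ω u φ_{j+1}` of `u ∈ L^2(Ω)`. -/
def DirichletEigensystem.coeff (D : DirichletEigensystem Ω) (u : Lp ℝ 2 (volume.restrict Ω))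
    (j : ℕ) : ℝ := inner ℝ (D.basis j) u

theorem DirichletEigensystem.coeff_eq_repr (D : DirichletEigensystem Ω)
    (u : Lp ℝ 2 (volume.restrict Ω)) (j : ℕ) : D.coeff u j = D.basis.repr u j :=
  (D.basis.repr_apply_apply u j).symm

theorem DirichletEigensystem.memlp_iff (D : DirichletEigensystem Ω) (r : ℝ)
    (u : Lp ℝ 2 (volume.restrict Ω)) :
    Memℓp (fun j => D.eigenvalue j ^ (r / 2) * D.coeff u j) 2 ↔
      Summable fun j => D.eigenvalue j ^ r * D.coeff u j ^ 2 := by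
  rw [memℓp_gen_iff (by norm_num)]
  have : (fun j => ‖D.eigenvalue j ^ (r / 2) * D.coeff u j‖ ^ (2 : ℝ≥0∞).toReal) =
      fun j => D.eigenvalue j ^ r * D.coeff u j ^ 2 := by
    funext j
    have h := D.eigenvalue_pos j
    rw [ENNReal.toReal_ofNat, Real.rpow_ofNat, Real.norm_eq_abs, sq_abs, mul_pow,
      ← Real.rpow_natCast (_ ^ (r / 2)), ← Real.rpow_mul h.le]
    congr 2
    push_cast
    ring
  rw [this]

/-- `Θ^r(Ω) = {u = ∑ ξ_j φ_j ∈ L^2(Ω) : ∑ λ_j^r ξ_j^2 < ∞}` as a subspace of `L^2(Ω)`, `r ≥ 0`. -/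
def thetaSubmodule (D : DirichletEigensystem Ω) (r : ℝ) :
    Submodule ℝ (Lp ℝ 2 (volume.restrict Ω)) where
  carrier := {u | Summable fun j => D.eigenvalue j ^ r * D.coeff u j ^ 2}
  zero_mem' := by
    simp [DirichletEigensystem.coeff]
  add_mem' := by
    intro u v hu hv
    rw [mem_ofPred_eq, ← D.memlp_iff] at hu hv ⊢
    convert hu.add hv using 1
    funext j
    simp [DirichletEigensystem.coeff, inner_add_right, mul_add]
  smul_mem' := by
    intro c u hu
    rw [mem_ofPred_eq, ← D.memlp_iff] at hu ⊢
    convert hu.const_smul c using 1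
    funext j
    simp only [DirichletEigensystem.coeff, inner_smul_right, Pi.smul_apply, smul_eq_mul]
    ring

/-- The space `Θ^r(Ω) = D((-Δ)^{r/2})`. A separate type, since it carries its own norm and not the
one of `L^2(Ω)`. -/
def Theta (D : DirichletEigensystem Ω) (r : ℝ) : Type := ↥(thetaSubmodule D r)

instance (D : DirichletEigensystem Ω) (r : ℝ) : AddCommGroup (Theta D r) :=
  inferInstanceAs (AddCommGroup ↥(thetaSubmodule D r))

instance (D : DirichletEigensystem Ω) (r : ℝ) : Module ℝ (Theta D r) :=
  inferInstanceAs (Module ℝ ↥(thetaSubmodule D r))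

/-- The inclusion `Θ^r(Ω) ⊆ L^2(Ω)`. -/
def Theta.toL2 {D : DirichletEigensystem Ω} {r : ℝ} :
    Theta D r →ₗ[ℝ] Lp ℝ 2 (volume.restrict Ω) := (thetaSubmodule D r).subtype

/-- The operator `A^r = (-Δ)^{r/2} : Θ^r(Ω) → L^2(Ω)`,
`A^r u = ∑ λ_j^{r/2} ξ_j φ_j` for `u = ∑ ξ_j φ_j`. -/
def Theta.power {D : DirichletEigensystem Ω} {r : ℝ} :
    Theta D r →ₗ[ℝ] Lp ℝ 2 (volume.restrict Ω) where
  toFun u := D.basis.repr.symm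
    ⟨fun j => D.eigenvalue j ^ (r / 2) * D.coeff u.toL2 j, (D.memlp_iff r u.toL2).2 u.2⟩
  map_add' u v := by
    rw [← map_add]
    congr 1
    ext j
    simp only [map_add, DirichletEigensystem.coeff, inner_add_right, mul_add, lp.coeFn_add,
      Pi.add_apply]
  map_smul' c u := by
    rw [RingHom.id_apply, ← map_smul]
    congr 1
    ext j
    simp only [map_smul, DirichletEigensystem.coeff, inner_smul_right, lp.coeFn_smul,
      Pi.smul_apply, smul_eq_mul]
    ring

theorem Theta.coeff_power {D : DirichletEigensystem Ω} {r : ℝ} (u : Theta D r) (j : ℕ) :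
    D.coeff u.power j = D.eigenvalue j ^ (r / 2) * D.coeff u.toL2 j := by
  rw [D.coeff_eq_repr]
  simp [Theta.power]

theorem Theta.power_injective {D : DirichletEigensystem Ω} {r : ℝ} :
    Function.Injective (Theta.power : Theta D r → Lp ℝ 2 (volume.restrict Ω)) := by
  intro u v huv
  apply Subtype.ext
  change u.toL2 = v.toL2
  apply D.basis.repr.injective
  ext j
  have h := congrArg (fun w => D.coeff w j) huv
  simp only [Theta.coeff_power] at h
  have h' := mul_left_cancel₀ (Real.rpow_pos_of_pos (D.eigenvalue_pos j) (r / 2)).ne' h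
  rwa [D.coeff_eq_repr, D.coeff_eq_repr] at h'

/-- `‖u‖_{Θ^r} = ‖A^r u‖_{L^2}`. -/
instance (D : DirichletEigensystem Ω) (r : ℝ) : NormedAddCommGroup (Theta D r) :=
  NormedAddCommGroup.induced (Theta D r) (Lp ℝ 2 (volume.restrict Ω))
    (Theta.power : Theta D r →ₗ[ℝ] _) Theta.power_injective

theorem Theta.norm_eq {D : DirichletEigensystem Ω} {r : ℝ} (u : Theta D r) :
    ‖u‖ = ‖u.power‖ := rfl

/-- `(u, v)_{Θ^r} = (A^r u, A^r v)_{L^2}`. -/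
instance (D : DirichletEigensystem Ω) (r : ℝ) : InnerProductSpace ℝ (Theta D r) where
  norm_smul_le c u := by
    rw [Theta.norm_eq, Theta.norm_eq, map_smul, norm_smul]
  inner u v := inner ℝ u.power v.power
  norm_sq_eq_re_inner u := by
    rw [Theta.norm_eq]
    exact norm_sq_eq_re_inner (𝕜 := ℝ) u.power
  conj_inner_symm u v := inner_conj_symm u.power v.power
  add_left u v w := by
    change inner ℝ (u + v).power w.power = inner ℝ u.power w.power + inner ℝ v.power w.power
    rw [map_add, inner_add_left]
  smul_left u v c := by
    change inner ℝ (c • u).power v.power = _ * inner ℝ u.power v.power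
    rw [map_smul, inner_smul_left]

/-- The eigenfunction `φ_{j+1}` as an element of `Θ^r(Ω)`. -/
def Theta.eigenfunction (D : DirichletEigensystem Ω) (r : ℝ) (j : ℕ) : Theta D r :=
  ⟨D.basis j, by
    change Summable _
    refine summable_of_ne_finset_zero (s := {j}) fun i hi => ?_
    have hij : i ≠ j := by simpa using hi
    simp [DirichletEigensystem.coeff, D.basis.orthonormal.2 hij]⟩

/-- The Hilbert space `E^r(Ω) = Θ^r(Ω) × Θ^{2-r}(Ω)`, with
`‖(u, v)‖^2 = ‖u‖_{Θ^r}^2 + ‖v‖_{Θ^{2-r}}^2`. -/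
abbrev ErSpace (D : DirichletEigensystem Ω) (r : ℝ) : Type :=
  WithLp 2 (Theta D r × Theta D (2 - r))

variable {D : DirichletEigensystem Ω} {r : ℝ}

/-- The quadratic form `½ (L 𝐮, 𝐮)_{E^r} = ∑ λ_j ξ_j η_j` (the extension of `∫ ∇u·∇v`) at
`𝐮 = (∑ ξ_j φ_j, ∑ η_j φ_j) ∈ E^r(Ω)`. -/
def quadForm (x : ErSpace D r) : ℝ :=
  ∑' j, D.eigenvalue j * D.coeff x.fst.toL2 j * D.coeff x.snd.toL2 j

/-- The series defining the quadratic form converges, with sum `(A^r u, A^{2-r} v)_{L^2}`. -/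
theorem quadForm_hasSum (x : ErSpace D r) :
    HasSum (fun j => D.eigenvalue j * D.coeff x.fst.toL2 j * D.coeff x.snd.toL2 j)
      (inner ℝ x.fst.power x.snd.power) := by
  refine (D.basis.hasSum_inner_mul_inner x.fst.power x.snd.power).congr_fun ?_
  intro j
  have h : inner ℝ x.fst.power (D.basis j) = D.coeff x.fst.power j := real_inner_comm _ _
  have h' : inner ℝ (D.basis j) x.snd.power = D.coeff x.snd.power j := rfl
  rw [h, h', Theta.coeff_power, Theta.coeff_power]
  have hl : D.eigenvalue j = D.eigenvalue j ^ (r / 2) * D.eigenvalue j ^ ((2 - r) / 2) := by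
    rw [← Real.rpow_add (D.eigenvalue_pos j), show r / 2 + (2 - r) / 2 = 1 by ring, Real.rpow_one]
  conv_lhs => rw [hl]
  ring

/-- `(1/(q+1)) ∫_Ω |u|^{q+1} + (1/(p+1)) ∫_Ω |v|^{p+1}`, as an element of `[0, ∞]`. -/
def powerTerm (p q : ℝ) (x : ErSpace D r) : ℝ≥0∞ :=
  ENNReal.ofReal (1 / (q + 1)) * (∫⁻ y in Ω, ENNReal.ofReal (|x.fst.toL2 y| ^ (q + 1))) +
    ENNReal.ofReal (1 / (p + 1)) * (∫⁻ y in Ω, ENNReal.ofReal (|x.snd.toL2 y| ^ (p + 1)))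

/-- The perturbation `∫_Ω k u + ∫_Ω h v`. -/
def perturbation (h k : Lp ℝ 2 (volume.restrict Ω)) (x : ErSpace D r) : ℝ :=
  (∫ y in Ω, k y * x.fst.toL2 y) + ∫ y in Ω, h y * x.snd.toL2 y

/-- The Lagrangian `I` of the perturbed system. -/
def lagrangian (p q : ℝ) (h k : Lp ℝ 2 (volume.restrict Ω)) (x : ErSpace D r) : ℝ :=
  quadForm x - (powerTerm p q x).toReal - perturbation h k x

/-- The cut-off functions `χ`. -/
structure IsCutoff (χ : ℝ → ℝ) : Prop where
  smooth : ContDiff ℝ ∞ χ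
  eq_one : ∀ t ≤ 1, χ t = 1
  eq_zero : ∀ t, 2 ≤ t → χ t = 0
  deriv_mem : ∀ t, 1 < t → t < 2 → -2 < deriv χ t ∧ deriv χ t < 0

/-- `ψ(𝐮) = χ(Q(𝐮)⁻¹ [(1/(q+1)) ∫ |u|^{q+1} + (1/(p+1)) ∫ |v|^{p+1}])`, where
`Q(𝐮) = 2 A √(I(𝐮)^2 + 1)`. -/
def cutoffFactor (p q : ℝ) (h k : Lp ℝ 2 (volume.restrict Ω)) (χ : ℝ → ℝ) (A : ℝ)
    (x : ErSpace D r) : ℝ :=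
  χ ((powerTerm p q x).toReal / (2 * A * √(lagrangian p q h k x ^ 2 + 1)))

/-- The modified functional
`J(𝐮) = ½ (L 𝐮, 𝐮) - (1/(q+1)) ∫ |u|^{q+1} - (1/(p+1)) ∫ |v|^{p+1} - ψ(𝐮) (∫ k u + ∫ h v)`.
It is written with values in `[-∞, ∞)`: `-∞` would be taken exactly where one of the power integrals
diverges, which never happens when `E^r(Ω) ⊆ L^{q+1}(Ω) × L^{p+1}(Ω)`. -/
def modifiedFunctional (p q : ℝ) (h k : Lp ℝ 2 (volume.restrict Ω)) (χ : ℝ → ℝ) (A : ℝ)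
    (x : ErSpace D r) : EReal :=
  ((quadForm x - cutoffFactor p q h k χ A x * perturbation h k x : ℝ) : EReal) -
    ((powerTerm p q x : ℝ≥0∞) : EReal)

variable (D r)

/-- The eigenvector `𝐞_{j+1}^+ = (1/√2) (λ^{-r/2} φ, λ^{r/2-1} φ)`, `λ = λ_{j+1}`, `φ = φ_{j+1}`. -/
def ePlus (j : ℕ) : ErSpace D r :=
  WithLp.toLp 2
    ((1 / √2 * D.eigenvalue j ^ (-r / 2)) • Theta.eigenfunction D r j,
      (1 / √2 * D.eigenvalue j ^ (r / 2 - 1)) • Theta.eigenfunction D (2 - r) j)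

/-- The eigenvector `𝐞_{j+1}^- = (1/√2) (λ^{-r/2} φ, -λ^{r/2-1} φ)`, `λ = λ_{j+1}`,
`φ = φ_{j+1}`. -/
def eMinus (j : ℕ) : ErSpace D r :=
  WithLp.toLp 2
    ((1 / √2 * D.eigenvalue j ^ (-r / 2)) • Theta.eigenfunction D r j,
      -(1 / √2 * D.eigenvalue j ^ (r / 2 - 1)) • Theta.eigenfunction D (2 - r) j)

/-- The eigenspace `{(u, σ (-Δ)^{r-1} u) : u ∈ Θ^r(Ω)}` of `L`, written in Fourier coefficients. -/
def eigenspaceL (σ : ℝ) : Submodule ℝ (ErSpace D r) where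
  carrier := {x | ∀ j, D.coeff x.snd.toL2 j =
    σ * (D.eigenvalue j ^ (r - 1) * D.coeff x.fst.toL2 j)}
  zero_mem' := by
    simp [DirichletEigensystem.coeff]
  add_mem' := by
    intro x y hx hy j
    have hx := hx j
    have hy := hy j
    simp only [DirichletEigensystem.coeff, WithLp.add_fst, WithLp.add_snd, map_add,
      inner_add_right] at hx hy ⊢
    rw [hx, hy]
    ring
  smul_mem' := by
    intro c x hx j
    have hx := hx j
    simp only [DirichletEigensystem.coeff, WithLp.smul_fst, WithLp.smul_snd, map_smul,
      inner_smul_right] at hx ⊢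
    rw [hx]
    ring

/-- `E^+ = {(u, (-Δ)^{r-1} u)}`. -/
abbrev EPlus : Submodule ℝ (ErSpace D r) := eigenspaceL D r 1

/-- `E^- = {(u, -(-Δ)^{r-1} u)}`. -/
abbrev EMinus : Submodule ℝ (ErSpace D r) := eigenspaceL D r (-1)

/-- `X^k = E^- ⊕ ⟨𝐞_1^+, …, 𝐞_k^+⟩`. -/
def XUpper (k : ℕ) : Submodule ℝ (ErSpace D r) :=
  EMinus D r ⊔ Submodule.span ℝ (ePlus D r '' {j | j < k})

/-- `X_n = ⟨𝐞_1^-, …, 𝐞_n^-⟩ ⊕ E^+`. -/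
def XLower (n : ℕ) : Submodule ℝ (ErSpace D r) :=
  Submodule.span ℝ (eMinus D r '' {j | j < n}) ⊔ EPlus D r

variable (R : ℕ → ℝ)

/-- `B_k^n`, the closed ball of radius `R_k` in `X^k ∩ X_n`. -/
def ballB (k n : ℕ) : Set (ErSpace D r) :=
  {x | x ∈ XUpper D r k ∧ x ∈ XLower D r n ∧ ‖x‖ ≤ R k}

/-- `Γ_k^n`: the odd continuous maps `B_k^n → X_n` that are the identity on the boundary of `B_k^n`
(relative to `X^k ∩ X_n`). Maps are represented by functions on the whole space, of which only the
values on `B_k^n` matter. -/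
def classGamma (k n : ℕ) : Set (ErSpace D r → ErSpace D r) :=
  {h | ContinuousOn h (ballB D r R k n) ∧ MapsTo h (ballB D r R k n) (XLower D r n) ∧
    (∀ x ∈ ballB D r R k n, h (-x) = -h x) ∧
    ∀ x ∈ ballB D r R k n, ‖x‖ = R k → h x = x}

/-- The half ball `U_k^n` of `B_{k+1}^n`
(the vector `𝐞_{k+1}^+` is `ePlus D r k` in the enumeration from `0`). -/
def halfBallU (k n : ℕ) : Set (ErSpace D r) :=
  {x | ∃ t ∈ Icc (0 : ℝ) (R (k + 1)), ∃ w ∈ ballB D r R (k + 1) n ∩ XUpper D r k,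
    x = t • ePlus D r k + w ∧ ‖x‖ ≤ R (k + 1)}

/-- `Λ_k^n`: the continuous maps `H : U_k^n → X_n` whose restriction to `B_k^n` belongs to `Γ_k^n`
and that are the identity on the part of
`Q_k^n = (∂B_{k+1}^n ∩ X^{k+1}) ∪ ((B_{R_{k+1}} \ B_{R_k}) ∩ X^k)` that lies in `U_k^n`. -/
def classLambda (k n : ℕ) : Set (ErSpace D r → ErSpace D r) :=
  {H | ContinuousOn H (halfBallU D r R k n) ∧
    MapsTo H (halfBallU D r R k n) (XLower D r n) ∧
    H ∈ classGamma D r R k n ∧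
    ∀ x ∈ halfBallU D r R k n,
      ‖x‖ = R (k + 1) ∨ (x ∈ XUpper D r k ∧ R k < ‖x‖ ∧ ‖x‖ ≤ R (k + 1)) → H x = x}

variable {D r}

/-- `c_k^n = inf_{h ∈ Γ_k^n} sup_{B_k^n} J ∘ h`. -/
def minimaxC (J : ErSpace D r → EReal) (k n : ℕ) : EReal :=
  ⨅ h ∈ classGamma D r R k n, ⨆ x ∈ ballB D r R k n, J (h x)

/-- `d_k^n = inf_{H ∈ Λ_k^n} sup_{U_k^n} J ∘ H`. -/
def minimaxD (J : ErSpace D r → EReal) (k n : ℕ) : EReal :=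
  ⨅ H ∈ classLambda D r R k n, ⨆ x ∈ halfBallU D r R k n, J (H x)

end Spaces

end

/-! A map `H` admissible for `d_k^n` lives on the half ball of `B_{k+1}^n` and is odd on the equator
`X^k`, so reflecting it gives a map admissible for `c_{k+1}^n` (`oddExtension_mem_classGamma`). If
`J` were even this would give `c_{k+1} ≤ d_k`; in general one pays for the failure of evenness. That
failure is of lower order: with `θ = max (1/(p+1)) (1/(q+1)) ≤ 1/2`, `J(x) ≤ M` implies `J(-x) ≤ M +
β(M+1)^θ` (`exists_modifiedFunctional_neg_le`). The perturbation is `O((S+1)^θ)` by Hölder, and on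
the support of the cutoff `S` is controlled by `|I|`, hence by `|J|`. With `c_k = d_k` the two facts
give `c_{k+1} ≤ c_k + O(c_k^θ)`, up to a shift making the terms positive. Such a sequence grows at
most like `k^{1/(1-θ)}` (`exists_le_mul_rpow_of_succ_le`), and `1/(1-θ)` is one of `(p+1)/p`,
`(q+1)/q`. -/

/-! ### Scalar inequalities and growth of recursive sequences. -/

theorem rpow_le_sqrt_of_le_half {θ y : ℝ} (hθ : θ ≤ 1 / 2) (hy : 1 ≤ y) : y ^ θ ≤ √y := by
  rw [Real.sqrt_eq_rpow]
  exact Real.rpow_le_rpow_of_exponent_le hy hθ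

/-- Absorption: `P` enters the right side only with a sublinear power. Splitting the power by
subadditivity and using AM-GM, `C√y ≤ (y/K + C²K)/2` with `y = KP + 1`, moves half of `P` to the
left. -/
theorem exists_le_mul_rpow_of_le_mul_rpow_add {θ C K : ℝ} (hθ0 : 0 < θ) (hθ : θ ≤ 1 / 2)
    (hC : 0 ≤ C) (hK : 0 < K) :
    ∃ β ≥ 0, ∀ s P : ℝ, 0 ≤ s → 0 ≤ P → P ≤ C * (s + K * P + 1) ^ θ → P ≤ β * (s + 1) ^ θ := by
  refine ⟨2 * C + 1 / K + C ^ 2 * K, by positivity, fun s P hs hP h => ?_⟩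
  have hKP : 0 ≤ K * P := by positivity
  have h1 : (s + K * P + 1) ^ θ ≤ (s + 1) ^ θ + (K * P + 1) ^ θ := by
    refine le_trans ?_ (Real.rpow_add_le_add_rpow (by positivity) (by positivity) hθ0.le
      (by linarith))
    exact Real.rpow_le_rpow (by positivity) (by linarith) hθ0.le
  have h2 := rpow_le_sqrt_of_le_half hθ (show 1 ≤ K * P + 1 by linarith)
  have h3 : C * √(K * P + 1) ≤ P / 2 + 1 / K / 2 + C ^ 2 * K / 2 := by
    have hsq := Real.sq_sqrt (show 0 ≤ K * P + 1 by linarith)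
    have : 2 * K * (C * √(K * P + 1)) ≤ 2 * K * (P / 2 + 1 / K / 2 + C ^ 2 * K / 2) := by
      have : 2 * K * (P / 2 + 1 / K / 2 + C ^ 2 * K / 2) = K * P + 1 + C ^ 2 * K ^ 2 := by
        field_simp
      rw [this]
      nlinarith [sq_nonneg (√(K * P + 1) - C * K)]
    exact le_of_mul_le_mul_left this (by positivity)
  have h4 : P ≤ 2 * C * (s + 1) ^ θ + (1 / K + C ^ 2 * K) := by
    have := mul_le_mul_of_nonneg_left (h1.trans (add_le_add_right h2 _)) hC
    linarith
  have h5 : 1 ≤ (s + 1) ^ θ := Real.one_le_rpow (by linarith) hθ0.le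
  have h6 : 0 ≤ 1 / K + C ^ 2 * K := by positivity
  nlinarith

/-- The value `s` of `J` is bounded above only. When it is very negative, the linear term beats the
correction, which is at most of order `√|s|`. -/
theorem add_mul_rpow_abs_le {θ β s M : ℝ} (hθ0 : 0 < θ) (hθ : θ ≤ 1 / 2) (hβ : 0 ≤ β)
    (hM : 0 ≤ M) (hs : s ≤ M) :
    s + β * (|s| + 1) ^ θ ≤ M + (1 + β + β ^ 2) * (M + 1) ^ θ := by
  have h1 : 1 ≤ (M + 1) ^ θ := Real.one_le_rpow (by linarith) hθ0.le
  rcases le_total 0 s with h0 | h0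
  · rw [abs_of_nonneg h0]
    have h2 : (s + 1) ^ θ ≤ (M + 1) ^ θ := Real.rpow_le_rpow (by linarith) (by linarith) hθ0.le
    have := mul_le_mul_of_nonneg_left h2 hβ
    nlinarith [sq_nonneg β]
  · rw [abs_of_nonpos h0]
    have h2 := rpow_le_sqrt_of_le_half hθ (show 1 ≤ -s + 1 by linarith)
    have hsq := Real.sq_sqrt (show 0 ≤ -s + 1 by linarith)
    have h3 := mul_le_mul_of_nonneg_left h2 hβ
    nlinarith [sq_nonneg (√(-s + 1) - β / 2), sq_nonneg β]

/-- Discrete Gronwall-type bound for `a_{m+1} ≤ a_m + β a_m^θ`. -/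
theorem exists_le_mul_rpow_of_succ_le {θ β : ℝ} (hθ0 : 0 < θ) (hθ : θ ≤ 1 / 2) (hβ : 0 ≤ β)
    {a : ℕ → ℝ} {m₀ : ℕ} (hm₀ : 1 ≤ m₀) (ha : ∀ m, 0 ≤ a m)
    (hsucc : ∀ m ≥ m₀, a (m + 1) ≤ a m + β * a m ^ θ) :
    ∃ α > 0, ∀ m ≥ m₀, a m ≤ α * (m : ℝ) ^ (1 / (1 - θ)) := by
  set γ := 1 / (1 - θ) with hγ
  have hγ1 : 1 ≤ γ := by
    rw [hγ, le_div_iff₀ (by linarith)]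
    linarith
  have hγθ : γ * θ = γ - 1 := by
    have : 1 - θ ≠ 0 := by linarith
    rw [hγ]
    field_simp
    ring
  -- The entry `a m₀` starts the induction; `β ^ γ` ensures `β α^θ ≤ α`, which closes its step.
  set α := max (max (a m₀) 1) (β ^ γ) with hα
  have hα1 : 1 ≤ α := (le_max_right _ _).trans (le_max_left _ _)
  have hα0 : 0 < α := by linarith
  have hβα : β * α ^ θ ≤ α := by
    have h1 : β ≤ α ^ (1 - θ) := by
      have h := Real.rpow_le_rpow (by positivity) (le_max_right _ _ : β ^ γ ≤ α)
        (show 0 ≤ 1 - θ by linarith)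
      rwa [← Real.rpow_mul hβ, hγ, one_div_mul_cancel (by linarith), Real.rpow_one] at h
    calc β * α ^ θ ≤ α ^ (1 - θ) * α ^ θ := by gcongr
      _ = α := by rw [← Real.rpow_add hα0]; simp
  refine ⟨α, hα0, fun m hm => ?_⟩
  induction m, hm using Nat.le_induction with
  | base =>
    have h1 : (1 : ℝ) ≤ (m₀ : ℝ) ^ γ :=
      Real.one_le_rpow (by exact_mod_cast hm₀) (by linarith)
    have h2 : a m₀ ≤ α := (le_max_left _ _).trans (le_max_left _ _)
    nlinarith
  | succ m hm ih =>
    have hm0 : (0 : ℝ) < m := by exact_mod_cast hm₀.trans hm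
    have h1 : a m ^ θ ≤ α ^ θ * (m : ℝ) ^ (γ - 1) := by
      rw [← hγθ, Real.rpow_mul hm0.le, ← Real.mul_rpow hα0.le (by positivity)]
      exact Real.rpow_le_rpow (ha m) ih hθ0.le
    -- Bernoulli: `(1 + 1/m)^γ ≥ 1 + γ/m ≥ 1 + 1/m`.
    have h2 : (m : ℝ) ^ γ + (m : ℝ) ^ (γ - 1) ≤ ((m + 1 : ℕ) : ℝ) ^ γ := by
      have h := one_add_mul_self_le_rpow_one_add (s := 1 / (m : ℝ))
        (by have : 0 < 1 / (m : ℝ) := by positivity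
            linarith) hγ1
      have e1 : ((m + 1 : ℕ) : ℝ) = m * (1 + 1 / m) := by
        push_cast
        field_simp
      rw [e1, Real.mul_rpow hm0.le (by positivity), Real.rpow_sub_one hm0.ne']
      have h3 : 0 < (m : ℝ) ^ γ := by positivity
      have h4 : 1 + 1 / (m : ℝ) ≤ (1 + 1 / (m : ℝ)) ^ γ := by
        refine le_trans ?_ h
        have : 0 < 1 / (m : ℝ) := by positivity
        nlinarith
      calc (m : ℝ) ^ γ + (m : ℝ) ^ γ / m = (m : ℝ) ^ γ * (1 + 1 / m) := by ring
        _ ≤ _ := by gcongr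
    calc a (m + 1) ≤ a m + β * a m ^ θ := hsucc m hm
      _ ≤ α * (m : ℝ) ^ γ + β * (α ^ θ * (m : ℝ) ^ (γ - 1)) := by gcongr
      _ = α * (m : ℝ) ^ γ + (β * α ^ θ) * (m : ℝ) ^ (γ - 1) := by ring
      _ ≤ α * (m : ℝ) ^ γ + α * (m : ℝ) ^ (γ - 1) := by gcongr
      _ = α * ((m : ℝ) ^ γ + (m : ℝ) ^ (γ - 1)) := by ring
      _ ≤ _ := by gcongr

/-! ### Orthogonality of the `𝐞_j^+` and odd extension from the half ball. -/

section OddExtension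

variable {N : ℕ} {Ω : Set (EuclideanSpace ℝ (Fin N))} {D : DirichletEigensystem Ω} {r : ℝ}

theorem Theta.inner_eigenfunction {s : ℝ} (j : ℕ) (u : Theta D s) :
    inner ℝ (Theta.eigenfunction D s j) u = D.eigenvalue j ^ s * D.coeff u.toL2 j := by
  have h : inner ℝ (Theta.eigenfunction D s j) u =
      inner ℝ (Theta.eigenfunction D s j).power u.power := rfl
  have h' : (Theta.eigenfunction D s j).power = D.eigenvalue j ^ (s / 2) • D.basis j := by
    apply D.basis.repr.injective
    ext i
    rw [← D.coeff_eq_repr, ← D.coeff_eq_repr, Theta.coeff_power]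
    change _ * inner ℝ (D.basis i) (D.basis j) = inner ℝ (D.basis i) (_ • D.basis j)
    rw [inner_smul_right]
    rcases eq_or_ne i j with rfl | hij
    · rfl
    · rw [D.basis.orthonormal.2 hij, mul_zero, mul_zero]
  rw [h, h', inner_smul_left]
  change _ * D.coeff u.power j = _
  rw [Theta.coeff_power, ← mul_assoc]
  congr 1
  rw [RCLike.conj_to_real, ← Real.rpow_add (D.eigenvalue_pos j)]
  congr 1
  ring

theorem inner_ePlus (j : ℕ) (x : ErSpace D r) :
    inner ℝ (ePlus D r j) x = 1 / √2 * (D.eigenvalue j ^ (r / 2) * D.coeff x.fst.toL2 j +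
      D.eigenvalue j ^ (1 - r / 2) * D.coeff x.snd.toL2 j) := by
  have hl := D.eigenvalue_pos j
  rw [WithLp.prod_inner_apply]
  change inner ℝ (_ • Theta.eigenfunction D r j) x.fst +
    inner ℝ (_ • Theta.eigenfunction D (2 - r) j) x.snd = _
  rw [inner_smul_left, inner_smul_left, Theta.inner_eigenfunction, Theta.inner_eigenfunction]
  have e1 : D.eigenvalue j ^ (-r / 2) * D.eigenvalue j ^ r = D.eigenvalue j ^ (r / 2) := by
    rw [← Real.rpow_add hl]; congr 1; ring
  have e2 : D.eigenvalue j ^ (r / 2 - 1) * D.eigenvalue j ^ (2 - r) =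
      D.eigenvalue j ^ (1 - r / 2) := by
    rw [← Real.rpow_add hl]; congr 1; ring
  rw [← e1, ← e2]
  simp only [RCLike.conj_to_real]
  ring

theorem coeff_ePlus_fst (i j : ℕ) : D.coeff (ePlus D r i).fst.toL2 j =
    1 / √2 * D.eigenvalue i ^ (-r / 2) * inner ℝ (D.basis j) (D.basis i) := by
  change inner ℝ (D.basis j) ((1 / √2 * D.eigenvalue i ^ (-r / 2)) • D.basis i) = _
  rw [inner_smul_right]

theorem coeff_ePlus_snd (i j : ℕ) : D.coeff (ePlus D r i).snd.toL2 j =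
    1 / √2 * D.eigenvalue i ^ (r / 2 - 1) * inner ℝ (D.basis j) (D.basis i) := by
  change inner ℝ (D.basis j) ((1 / √2 * D.eigenvalue i ^ (r / 2 - 1)) • D.basis i) = _
  rw [inner_smul_right]

theorem inner_ePlus_self (j : ℕ) : inner ℝ (ePlus D r j) (ePlus D r j) = (1 : ℝ) := by
  have hl := D.eigenvalue_pos j
  rw [inner_ePlus, coeff_ePlus_fst, coeff_ePlus_snd, real_inner_self_eq_norm_sq,
    D.basis.orthonormal.1 j]
  have e1 : D.eigenvalue j ^ (r / 2) * D.eigenvalue j ^ (-r / 2) = 1 := by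
    rw [← Real.rpow_add hl, show r / 2 + -r / 2 = 0 by ring, Real.rpow_zero]
  have e2 : D.eigenvalue j ^ (1 - r / 2) * D.eigenvalue j ^ (r / 2 - 1) = 1 := by
    rw [← Real.rpow_add hl, show 1 - r / 2 + (r / 2 - 1) = 0 by ring, Real.rpow_zero]
  have e3 : (1 / √2 : ℝ) * (1 / √2) = 1 / 2 := by
    rw [div_mul_div_comm, Real.mul_self_sqrt (by norm_num), one_mul]
  linear_combination (1 / √2 * (1 / √2)) * (e1 + e2) + 2 * e3

theorem norm_ePlus (j : ℕ) : ‖ePlus D r j‖ = 1 := by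
  rw [norm_eq_sqrt_real_inner, inner_ePlus_self, Real.sqrt_one]

theorem inner_ePlus_of_mem_EMinus (j : ℕ) {x : ErSpace D r} (hx : x ∈ EMinus D r) :
    inner ℝ (ePlus D r j) x = (0 : ℝ) := by
  rw [inner_ePlus, hx j]
  have e : D.eigenvalue j ^ (1 - r / 2) * D.eigenvalue j ^ (r - 1) = D.eigenvalue j ^ (r / 2) := by
    rw [← Real.rpow_add (D.eigenvalue_pos j)]; congr 1; ring
  linear_combination (-(1 / √2) * D.coeff x.fst.toL2 j) * e

theorem inner_ePlus_of_ne {i j : ℕ} (hij : i ≠ j) :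
    inner ℝ (ePlus D r i) (ePlus D r j) = (0 : ℝ) := by
  rw [inner_ePlus, coeff_ePlus_fst, coeff_ePlus_snd, D.basis.orthonormal.2 hij]
  ring

theorem inner_ePlus_of_mem_XUpper {k : ℕ} {x : ErSpace D r} (hx : x ∈ XUpper D r k) :
    inner ℝ (ePlus D r k) x = (0 : ℝ) := by
  suffices h : XUpper D r k ≤ (innerₛₗ ℝ (ePlus D r k)).ker from h hx
  refine sup_le (fun y hy => inner_ePlus_of_mem_EMinus k hy) (Submodule.span_le.2 ?_)
  rintro _ ⟨j, hj, rfl⟩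
  exact inner_ePlus_of_ne (ne_of_gt hj)

theorem ePlus_mem_EPlus (j : ℕ) : ePlus D r j ∈ EPlus D r := by
  intro i
  rw [coeff_ePlus_fst, coeff_ePlus_snd]
  rcases eq_or_ne i j with rfl | hij
  · have e : D.eigenvalue i ^ (r - 1) * D.eigenvalue i ^ (-r / 2) =
        D.eigenvalue i ^ (r / 2 - 1) := by
      rw [← Real.rpow_add (D.eigenvalue_pos i)]; congr 1; ring
    rw [← e]
    ring
  · rw [D.basis.orthonormal.2 hij]
    ring

theorem ePlus_mem_XLower (n j : ℕ) : ePlus D r j ∈ XLower D r n :=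
  Submodule.mem_sup_right (ePlus_mem_EPlus j)

theorem ePlus_mem_XUpper {j k : ℕ} (hj : j < k) : ePlus D r j ∈ XUpper D r k :=
  Submodule.mem_sup_right (Submodule.subset_span ⟨j, hj, rfl⟩)

theorem XUpper_mono {k l : ℕ} (hkl : k ≤ l) : XUpper D r k ≤ XUpper D r l :=
  sup_le_sup_left (Submodule.span_mono (image_mono fun _ hj => lt_of_lt_of_le hj hkl)) _

/-- Orthogonal projection along `𝐞_{k+1}^+`: this vector has norm one and is orthogonal to `X^k`, so
the coordinate `t` of the half ball is an inner product. -/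
theorem sub_inner_smul_mem_XUpper {k : ℕ} {x : ErSpace D r} (hx : x ∈ XUpper D r (k + 1)) :
    x - (inner ℝ (ePlus D r k) x : ℝ) • ePlus D r k ∈ XUpper D r k := by
  suffices h : XUpper D r (k + 1) ≤ (XUpper D r k).comap
      (LinearMap.id - (innerₛₗ ℝ (ePlus D r k)).smulRight (ePlus D r k)) from h hx
  have hfix : ∀ y ∈ XUpper D r k, y - (inner ℝ (ePlus D r k) y : ℝ) • ePlus D r k ∈
      XUpper D r k := fun y hy => by
    rwa [inner_ePlus_of_mem_XUpper hy, zero_smul, sub_zero]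
  refine sup_le (fun y hy => hfix y (Submodule.mem_sup_left hy)) (Submodule.span_le.2 ?_)
  rintro _ ⟨j, hj, rfl⟩
  rcases (Nat.lt_succ_iff.1 hj).lt_or_eq with h | rfl
  · exact hfix _ (ePlus_mem_XUpper h)
  · change ePlus D r j - (inner ℝ (ePlus D r j) (ePlus D r j) : ℝ) • ePlus D r j ∈ XUpper D r j
    rw [inner_ePlus_self, one_smul, sub_self]
    exact zero_mem _

theorem norm_sub_inner_smul_le (k : ℕ) (x : ErSpace D r) :
    ‖x - (inner ℝ (ePlus D r k) x : ℝ) • ePlus D r k‖ ≤ ‖x‖ := by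
  refine abs_le_of_sq_le_sq' ?_ (norm_nonneg _) |>.2
  rw [norm_sub_sq_real, inner_smul_right, norm_smul, norm_ePlus, real_inner_comm, mul_one,
    Real.norm_eq_abs, sq_abs]
  nlinarith [sq_nonneg (inner ℝ (ePlus D r k) x : ℝ)]

variable {R : ℕ → ℝ} {k n : ℕ}

theorem neg_mem_ballB {x : ErSpace D r} (hx : x ∈ ballB D r R k n) : -x ∈ ballB D r R k n :=
  ⟨neg_mem hx.1, neg_mem hx.2.1, (norm_neg x).trans_le hx.2.2⟩

/-- The witness `t` is the inner product with `𝐞_{k+1}^+`, at most `‖x‖` by Cauchy–Schwarz; `w` is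
the projection, which does not increase the norm. -/
theorem mem_halfBallU_of_inner_nonneg {x : ErSpace D r} (hx : x ∈ ballB D r R (k + 1) n)
    (h : 0 ≤ (inner ℝ (ePlus D r k) x : ℝ)) : x ∈ halfBallU D r R k n := by
  have hw := sub_inner_smul_mem_XUpper hx.1
  refine ⟨_, ⟨h, ?_⟩, _, ⟨⟨XUpper_mono k.le_succ hw, sub_mem hx.2.1
    (Submodule.smul_mem _ _ (ePlus_mem_XLower n k)),
    (norm_sub_inner_smul_le k x).trans hx.2.2⟩, hw⟩, (add_sub_cancel _ _).symm, hx.2.2⟩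
  have := real_inner_le_norm (ePlus D r k) x
  rw [norm_ePlus, one_mul] at this
  exact this.trans hx.2.2

open Classical in
/-- The odd extension to `B_{k+1}^n` of a map on the half ball `U_k^n`. -/
noncomputable def oddExtension (k : ℕ) (H : ErSpace D r → ErSpace D r) (x : ErSpace D r) :
    ErSpace D r :=
  if 0 ≤ (inner ℝ (ePlus D r k) x : ℝ) then H x else -H (-x)

/-- The equator lies in `X^k`: inside radius `R_k` oddness comes from `Γ_k^n`, and beyond it `H` is
the identity. -/
theorem classLambda_odd {H : ErSpace D r → ErSpace D r} (hH : H ∈ classLambda D r R k n)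
    {x : ErSpace D r} (hx : x ∈ ballB D r R (k + 1) n)
    (h : (inner ℝ (ePlus D r k) x : ℝ) = 0) : H (-x) = -H x := by
  have hk : x ∈ XUpper D r k := by
    have := sub_inner_smul_mem_XUpper hx.1
    rwa [h, zero_smul, sub_zero] at this
  have hU := mem_halfBallU_of_inner_nonneg hx h.ge
  have hU' := mem_halfBallU_of_inner_nonneg (neg_mem_ballB hx)
    (by rw [inner_neg_right, h, neg_zero])
  rcases le_or_gt ‖x‖ (R k) with hle | hgt
  · exact hH.2.2.1.2.2.1 x ⟨hk, hx.2.1, hle⟩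
  · rw [hH.2.2.2 x hU (Or.inr ⟨hk, hgt, hx.2.2⟩), hH.2.2.2 (-x) hU'
      (Or.inr ⟨neg_mem hk, by rwa [norm_neg], by rw [norm_neg]; exact hx.2.2⟩)]

theorem oddExtension_mem_classGamma {H : ErSpace D r → ErSpace D r}
    (hH : H ∈ classLambda D r R k n) : oddExtension k H ∈ classGamma D r R (k + 1) n := by
  have hcont : Continuous fun x : ErSpace D r => (inner ℝ (ePlus D r k) x : ℝ) :=
    continuous_const.inner continuous_id
  have hneg : ∀ x : ErSpace D r, (inner ℝ (ePlus D r k) (-x) : ℝ) = -inner ℝ (ePlus D r k) x :=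
    fun x => inner_neg_right _ _
  refine ⟨?_, fun x hx => ?_, fun x hx => ?_, fun x hx hxR => ?_⟩
  -- The two branches meet only on the equator, where oddness of `H` makes them agree.
  · refine ContinuousOn.if (fun x hx => ?_) ?_ ?_
    · have h0 : (0 : ℝ) = inner ℝ (ePlus D r k) x :=
        frontier_le_subset_eq continuous_const hcont hx.2
      rw [classLambda_odd hH hx.1 h0.symm, neg_neg]
    · refine hH.1.mono fun x hx => mem_halfBallU_of_inner_nonneg hx.1 ?_
      have := (isClosed_le continuous_const hcont).closure_eq ▸ hx.2
      exact this
    · refine (hH.1.comp continuous_neg.continuousOn fun x hx => ?_).neg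
      have h1 : (inner ℝ (ePlus D r k) x : ℝ) ≤ 0 :=
        closure_minimal (fun y hy => (not_le.1 hy).le)
          (isClosed_le hcont continuous_const) hx.2
      exact mem_halfBallU_of_inner_nonneg (neg_mem_ballB hx.1) (by rw [hneg]; linarith)
  · unfold oddExtension
    split_ifs with h
    · exact hH.2.1 (mem_halfBallU_of_inner_nonneg hx h)
    · exact neg_mem (hH.2.1 (mem_halfBallU_of_inner_nonneg (neg_mem_ballB hx)
        (by rw [hneg]; linarith)))
  · unfold oddExtension
    rw [hneg]
    -- If both signs are nonnegative, the point is on the equator; both negative is impossible.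
    split_ifs with h1 h2 h2
    · exact classLambda_odd hH hx (by linarith)
    · rw [neg_neg]
    · rw [neg_neg]
    · linarith
  · unfold oddExtension
    split_ifs with h
    · exact hH.2.2.2 x (mem_halfBallU_of_inner_nonneg hx h) (Or.inl hxR)
    · rw [hH.2.2.2 (-x) (mem_halfBallU_of_inner_nonneg (neg_mem_ballB hx)
        (by rw [hneg]; linarith)) (Or.inl (by rwa [norm_neg])), neg_neg]

/-- Every value of the odd extension is `H x` or `-H x` for some `x` in the half ball. -/
theorem minimaxC_succ_le {J : ErSpace D r → EReal} {H : ErSpace D r → ErSpace D r} {b : EReal}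
    (hH : H ∈ classLambda D r R k n)
    (hb : ∀ x ∈ halfBallU D r R k n, J (H x) ≤ b ∧ J (-H x) ≤ b) :
    minimaxC R J (k + 1) n ≤ b := by
  refine (iInf₂_le _ (oddExtension_mem_classGamma hH)).trans (iSup₂_le fun x hx => ?_)
  unfold oddExtension
  split_ifs with h
  · exact (hb x (mem_halfBallU_of_inner_nonneg hx h)).1
  · exact (hb (-x) (mem_halfBallU_of_inner_nonneg (neg_mem_ballB hx)
      (by rw [inner_neg_right]; linarith))).2

end OddExtension

/-! ### How far `J` is from being even. -/

section Deviation

theorem IsCutoff.exists_abs_le {χ : ℝ → ℝ} (hχ : IsCutoff χ) : ∃ K > 0, ∀ t, |χ t| ≤ K := by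
  obtain ⟨K, hK⟩ := (isCompact_Icc (a := (1 : ℝ)) (b := 2)).exists_bound_of_continuousOn
    hχ.smooth.continuous.continuousOn
  refine ⟨max K 1, by positivity, fun t => ?_⟩
  rcases le_or_gt t 1 with h1 | h1
  · rw [hχ.eq_one t h1, abs_one]
    exact le_max_right _ _
  rcases le_or_gt 2 t with h2 | h2
  · rw [hχ.eq_zero t h2, abs_zero]
    positivity
  · exact (hK t ⟨h1.le, h2.le⟩).trans (le_max_left _ _)

/-- Hölder's inequality on a finite measure space, phrased through the integral occurring in
`powerTerm`. -/
theorem exists_norm_Lp_two_le {α : Type*} [MeasurableSpace α] (μ : Measure α) [IsFiniteMeasure μ]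
    {q : ℝ} (hq : 1 ≤ q) :
    ∃ C ≥ 0, ∀ u : Lp ℝ 2 μ, (∫⁻ y, ENNReal.ofReal (|u y| ^ (q + 1)) ∂μ) ≠ ⊤ →
      ‖u‖ ≤ C * (∫⁻ y, ENNReal.ofReal (|u y| ^ (q + 1)) ∂μ).toReal ^ (1 / (q + 1)) := by
  have hq1 : (ENNReal.ofReal (q + 1)).toReal = q + 1 := ENNReal.toReal_ofReal (by linarith)
  set V : ℝ≥0∞ := μ univ ^ (1 / (2 : ℝ≥0∞).toReal - 1 / (ENNReal.ofReal (q + 1)).toReal) with hV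
  have hVtop : V ≠ ⊤ := by
    refine ENNReal.rpow_ne_top_of_nonneg ?_ (measure_ne_top μ _)
    rw [hq1, ENNReal.toReal_ofNat, sub_nonneg]
    exact one_div_le_one_div_of_le (by norm_num) (by linarith)
  refine ⟨V.toReal, ENNReal.toReal_nonneg, fun u hu => ?_⟩
  have h2 : (2 : ℝ≥0∞) ≤ ENNReal.ofReal (q + 1) := by
    rw [← ENNReal.ofReal_ofNat]
    exact ENNReal.ofReal_le_ofReal (by linarith)
  have h := eLpNorm_le_eLpNorm_mul_rpow_measure_univ h2 (Lp.aestronglyMeasurable u)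
  rw [eLpNorm_eq_lintegral_rpow_enorm_toReal (two_pos.trans_le h2).ne' ENNReal.ofReal_ne_top,
    ← hV, hq1] at h
  have e : ∀ y, ‖u y‖ₑ ^ (q + 1) = ENNReal.ofReal (|u y| ^ (q + 1)) := fun y => by
    rw [← ofReal_norm, Real.norm_eq_abs,
      ENNReal.ofReal_rpow_of_nonneg (abs_nonneg _) (by linarith)]
  simp only [e] at h
  rw [Lp.norm_def, mul_comm, ENNReal.toReal_rpow, ← ENNReal.toReal_mul]
  exact ENNReal.toReal_mono (ENNReal.mul_ne_top
    (ENNReal.rpow_ne_top_of_nonneg (by positivity) hu) hVtop) h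

variable {N : ℕ} {Ω : Set (EuclideanSpace ℝ (Fin N))} {D : DirichletEigensystem Ω} {r : ℝ}

theorem exists_abs_integral_mul_le [IsFiniteMeasure (volume.restrict Ω)] {q θ : ℝ} (hq : 1 ≤ q)
    (hθ : 1 / (q + 1) ≤ θ) (k : Lp ℝ 2 (volume.restrict Ω)) :
    ∃ C ≥ 0, ∀ u : Lp ℝ 2 (volume.restrict Ω), ∀ S : ℝ,
      (∫⁻ y in Ω, ENNReal.ofReal (|u y| ^ (q + 1))) ≠ ⊤ →
      1 / (q + 1) * (∫⁻ y in Ω, ENNReal.ofReal (|u y| ^ (q + 1))).toReal ≤ S →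
      |∫ y in Ω, k y * u y| ≤ C * (S + 1) ^ θ := by
  obtain ⟨C, hC, h⟩ := exists_norm_Lp_two_le (volume.restrict Ω) hq
  refine ⟨‖k‖ * (C * (q + 1) ^ (1 / (q + 1))), by positivity, fun u S hu hS => ?_⟩
  have h1 : |∫ y in Ω, k y * u y| ≤ ‖k‖ * ‖u‖ := by
    have := abs_real_inner_le_norm k u
    rw [L2.inner_def] at this
    simpa [mul_comm] using this
  set T := (∫⁻ y in Ω, ENNReal.ofReal (|u y| ^ (q + 1))).toReal with hT
  have hT0 : 0 ≤ T := ENNReal.toReal_nonneg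
  have hS0 : 0 ≤ S := le_trans (by positivity) hS
  have hTS : T ≤ (q + 1) * (S + 1) := by
    rw [one_div_mul_eq_div, div_le_iff₀ (by linarith)] at hS
    nlinarith
  calc _ ≤ ‖k‖ * ‖u‖ := h1
    _ ≤ ‖k‖ * (C * T ^ (1 / (q + 1))) := by gcongr; exact h u hu
    _ ≤ ‖k‖ * (C * ((q + 1) * (S + 1)) ^ (1 / (q + 1))) := by gcongr
    _ = ‖k‖ * (C * (q + 1) ^ (1 / (q + 1))) * (S + 1) ^ (1 / (q + 1)) := by
      rw [Real.mul_rpow (by linarith) (by linarith)]; ring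
    -- The base `S + 1` is at least `1`, so the exponent can be raised to the common `θ`.
    _ ≤ _ := by
      gcongr
      linarith

theorem exists_abs_perturbation_le [IsFiniteMeasure (volume.restrict Ω)] {p q θ : ℝ} (hp : 1 ≤ p)
    (hq : 1 ≤ q) (hθp : 1 / (p + 1) ≤ θ) (hθq : 1 / (q + 1) ≤ θ)
    (h k : Lp ℝ 2 (volume.restrict Ω)) :
    ∃ C ≥ 0, ∀ x : ErSpace D r, powerTerm p q x ≠ ⊤ →
      |perturbation h k x| ≤ C * ((powerTerm p q x).toReal + 1) ^ θ := by
  obtain ⟨C₁, hC₁, h₁⟩ := exists_abs_integral_mul_le hq hθq k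
  obtain ⟨C₂, hC₂, h₂⟩ := exists_abs_integral_mul_le hp hθp h
  refine ⟨C₁ + C₂, by positivity, fun x hx => ?_⟩
  have hq0 : 0 < 1 / (q + 1) := by positivity
  have hp0 : 0 < 1 / (p + 1) := by positivity
  obtain ⟨hx₁, hx₂⟩ := ENNReal.add_ne_top.1 hx
  have hu : (∫⁻ y in Ω, ENNReal.ofReal (|x.fst.toL2 y| ^ (q + 1))) ≠ ⊤ := fun ht => hx₁ (by
    rw [ht]; exact ENNReal.mul_top (ENNReal.ofReal_pos.2 hq0).ne')
  have hv : (∫⁻ y in Ω, ENNReal.ofReal (|x.snd.toL2 y| ^ (p + 1))) ≠ ⊤ := fun ht => hx₂ (by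
    rw [ht]; exact ENNReal.mul_top (ENNReal.ofReal_pos.2 hp0).ne')
  have hS : (powerTerm p q x).toReal =
      1 / (q + 1) * (∫⁻ y in Ω, ENNReal.ofReal (|x.fst.toL2 y| ^ (q + 1))).toReal +
      1 / (p + 1) * (∫⁻ y in Ω, ENNReal.ofReal (|x.snd.toL2 y| ^ (p + 1))).toReal := by
    rw [powerTerm, ENNReal.toReal_add hx₁ hx₂, ENNReal.toReal_mul, ENNReal.toReal_mul,
      ENNReal.toReal_ofReal hq0.le, ENNReal.toReal_ofReal hp0.le]
  have b₁ := h₁ x.fst.toL2 (powerTerm p q x).toReal hu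
    (by rw [hS]; exact le_add_of_nonneg_right (by positivity))
  have b₂ := h₂ x.snd.toL2 (powerTerm p q x).toReal hv
    (by rw [hS]; exact le_add_of_nonneg_left (by positivity))
  rw [add_mul]
  exact (abs_add_le _ _).trans (add_le_add b₁ b₂)

theorem quadForm_neg (x : ErSpace D r) : quadForm (-x) = quadForm x := by
  simp [quadForm, DirichletEigensystem.coeff]

theorem powerTerm_neg (p q : ℝ) (x : ErSpace D r) : powerTerm p q (-x) = powerTerm p q x := by
  have e : ∀ (s : ℝ) (u : Lp ℝ 2 (volume.restrict Ω)),
      ∫⁻ y in Ω, ENNReal.ofReal (|(-u : Lp ℝ 2 (volume.restrict Ω)) y| ^ s) =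
        ∫⁻ y in Ω, ENNReal.ofReal (|u y| ^ s) := fun s u => by
    refine lintegral_congr_ae ?_
    filter_upwards [Lp.coeFn_neg u] with y hy
    rw [hy, Pi.neg_apply, abs_neg]
  simp only [powerTerm, WithLp.neg_fst, WithLp.neg_snd, map_neg, e]

theorem perturbation_neg (h k : Lp ℝ 2 (volume.restrict Ω)) (x : ErSpace D r) :
    perturbation h k (-x) = -perturbation h k x := by
  have e : ∀ f u : Lp ℝ 2 (volume.restrict Ω),
      ∫ y in Ω, f y * (-u : Lp ℝ 2 (volume.restrict Ω)) y = -∫ y in Ω, f y * u y :=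
    fun f u => by
      rw [← integral_neg]
      refine integral_congr_ae ?_
      filter_upwards [Lp.coeFn_neg u] with y hy
      rw [hy, Pi.neg_apply, mul_neg]
  simp only [perturbation, WithLp.neg_fst, WithLp.neg_snd, map_neg, e]
  ring

/-- Here `S`, `P`, `I`, `s` stand for the power term, the perturbation, the Lagrangian and `J`.
Where the cutoff is nonzero, `S < 4A√(I²+1)`, so `|P|` is bounded by the power `θ` of an affine
function of `|s|` and `|P|`, and the absorption lemma applies. -/
theorem exists_abs_cutoff_mul_le {θ C K A : ℝ} (hθ0 : 0 < θ) (hθ : θ ≤ 1 / 2) (hC : 0 ≤ C)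
    (hK : 0 < K) (hA : 0 < A) {χ : ℝ → ℝ} (hχ : IsCutoff χ) (hχK : ∀ t, |χ t| ≤ K) :
    ∃ β ≥ 0, ∀ S P I s : ℝ, 0 ≤ S → |P| ≤ C * (S + 1) ^ θ → |I| ≤ |s| + (K + 1) * |P| →
      |χ (S / (2 * A * √(I ^ 2 + 1))) * P| ≤ β * (|s| + 1) ^ θ := by
  obtain ⟨β, hβ, h⟩ := exists_le_mul_rpow_of_le_mul_rpow_add hθ0 hθ
    (show 0 ≤ C * (4 * A + 1) ^ θ by positivity) (show 0 < K + 1 by linarith)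
  refine ⟨K * β, by positivity, fun S P I s hS hP hI => ?_⟩
  rcases le_or_gt 2 (S / (2 * A * √(I ^ 2 + 1))) with h2 | h2
  · rw [hχ.eq_zero _ h2, zero_mul, abs_zero]
    positivity
  rw [abs_mul, mul_assoc K]
  refine mul_le_mul (hχK _) (h _ _ (abs_nonneg _) (abs_nonneg _) (hP.trans ?_))
    (abs_nonneg _) hK.le
  have hsqrt : √(I ^ 2 + 1) ≤ |I| + 1 := by
    rw [Real.sqrt_le_left (by positivity), add_sq, sq_abs]
    nlinarith [abs_nonneg I]
  have hSI : S + 1 ≤ (4 * A + 1) * (|s| + (K + 1) * |P| + 1) := by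
    rw [div_lt_iff₀ (by positivity)] at h2
    have := mul_le_mul_of_nonneg_left hsqrt (show 0 ≤ 4 * A by positivity)
    have := mul_le_mul_of_nonneg_left hI (show 0 ≤ 4 * A + 1 by positivity)
    nlinarith [abs_nonneg I]
  rw [mul_assoc C, ← Real.mul_rpow (by positivity) (by positivity)]
  gcongr

/-- The deviation of the modified functional from evenness. -/
theorem exists_modifiedFunctional_neg_le [IsFiniteMeasure (volume.restrict Ω)] {p q θ : ℝ}
    (hp : 1 ≤ p) (hq : 1 ≤ q) (hθp : 1 / (p + 1) ≤ θ) (hθq : 1 / (q + 1) ≤ θ) (hθ : θ ≤ 1 / 2)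
    (h k : Lp ℝ 2 (volume.restrict Ω)) {χ : ℝ → ℝ} (hχ : IsCutoff χ) {A : ℝ} (hA : 0 < A) :
    ∃ β ≥ 0, ∀ M : ℝ, 0 ≤ M → ∀ x : ErSpace D r, modifiedFunctional p q h k χ A x ≤ (M : EReal) →
      modifiedFunctional p q h k χ A (-x) ≤ ((M + β * (M + 1) ^ θ : ℝ) : EReal) := by
  have hθ0 : 0 < θ := lt_of_lt_of_le (by positivity) hθp
  obtain ⟨C, hC, hpert⟩ := exists_abs_perturbation_le (D := D) (r := r) hp hq hθp hθq h k
  obtain ⟨K, hK, hχK⟩ := hχ.exists_abs_le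
  obtain ⟨β, hβ, hcut⟩ := exists_abs_cutoff_mul_le hθ0 hθ hC hK hA hχ hχK
  refine ⟨1 + 2 * β + (2 * β) ^ 2, by positivity, fun M hM x hx => ?_⟩
  -- If a power integral diverges at `x`, it does so at `-x`, where `J` is then `-∞`.
  by_cases htop : powerTerm p q x = ⊤
  · rw [modifiedFunctional, powerTerm_neg, htop, EReal.coe_ennreal_top, EReal.sub_top]
    exact bot_le
  have hS : ((powerTerm p q x : ℝ≥0∞) : EReal) = ((powerTerm p q x).toReal : EReal) :=
    by
    rw [← EReal.toReal_coe_ennreal,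
      EReal.coe_toReal (by simpa using htop) (EReal.coe_ennreal_ne_bot _)]
  have hS0 : 0 ≤ (powerTerm p q x).toReal := ENNReal.toReal_nonneg
  have hP := hpert x htop
  rw [modifiedFunctional, hS, ← EReal.coe_sub, EReal.coe_le_coe_iff] at hx
  rw [modifiedFunctional, powerTerm_neg, hS, ← EReal.coe_sub, EReal.coe_le_coe_iff,
    quadForm_neg, perturbation_neg]
  set s := quadForm x - cutoffFactor p q h k χ A x * perturbation h k x -
    (powerTerm p q x).toReal with hs
  -- Since `J(-x) = s + (ψ(x) + ψ(-x)) P`, with `P` the perturbation at `x`, two cutoff terms must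
  -- be bounded; hence `2 * β`.
  refine le_trans ?_ (add_mul_rpow_abs_le hθ0 hθ (show 0 ≤ 2 * β by positivity) hM hx)
  have hψ : |cutoffFactor p q h k χ A x * perturbation h k x| ≤ K * |perturbation h k x| := by
    rw [abs_mul]
    exact mul_le_mul_of_nonneg_right (hχK _) (abs_nonneg _)
  have hI : |lagrangian p q h k x| ≤ |s| + (K + 1) * |perturbation h k x| := by
    have e : lagrangian p q h k x = s + (cutoffFactor p q h k χ A x * perturbation h k x -
        perturbation h k x) := by rw [lagrangian, hs]; ring
    rw [e]
    linarith [abs_add_le s (cutoffFactor p q h k χ A x * perturbation h k x -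
      perturbation h k x), abs_sub (cutoffFactor p q h k χ A x * perturbation h k x)
      (perturbation h k x)]
  have hI' : |lagrangian p q h k (-x)| ≤ |s| + (K + 1) * |perturbation h k x| := by
    have e : lagrangian p q h k (-x) = s + (cutoffFactor p q h k χ A x * perturbation h k x +
        perturbation h k x) := by
      rw [lagrangian, quadForm_neg, powerTerm_neg, perturbation_neg, hs]; ring
    rw [e]
    linarith [abs_add_le s (cutoffFactor p q h k χ A x * perturbation h k x +
      perturbation h k x), abs_add_le (cutoffFactor p q h k χ A x * perturbation h k x)
      (perturbation h k x)]
  have b := hcut _ _ _ s hS0 hP hI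
  have b' := hcut _ _ _ s hS0 hP hI'
  rw [← powerTerm_neg p q x] at b'
  change |cutoffFactor p q h k χ A x * perturbation h k x| ≤ _ at b
  change |cutoffFactor p q h k χ A (-x) * perturbation h k x| ≤ _ at b'
  linarith [(abs_le.1 b).2, (abs_le.1 b').2]

end Deviation

/-! ### Passage to the limit and conclusion. -/

/-- The strict inequality `d < M` yields, for large `n`, a map `H` with `J ∘ H` below `M`, although
the infimum need not be attained. -/
theorem minimaxC_limit_succ_le {N : ℕ} {Ω : Set (EuclideanSpace ℝ (Fin N))}
    {D : DirichletEigensystem Ω} {r : ℝ} {J : ErSpace D r → EReal} {R : ℕ → ℝ} {ν : ℕ → ℕ}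
    {m : ℕ} {c' d M b : ℝ} (hdM : d < M) (hMb : M ≤ b)
    (hJ : ∀ x, J x ≤ (M : EReal) → J (-x) ≤ (b : EReal))
    (hc : Tendsto (fun n => minimaxC R J (m + 1) (ν n)) atTop (𝓝 (c' : EReal)))
    (hd : Tendsto (fun n => minimaxD R J m (ν n)) atTop (𝓝 (d : EReal))) : c' ≤ b := by
  rw [← EReal.coe_le_coe_iff]
  refine le_of_tendsto hc ?_
  filter_upwards [hd.eventually_lt_const (EReal.coe_lt_coe_iff.2 hdM)] with n hn
  simp only [minimaxD, iInf_lt_iff] at hn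
  obtain ⟨H, hH, hlt⟩ := hn
  refine minimaxC_succ_le hH fun x hx => ?_
  have hx' : J (H x) ≤ (M : EReal) := (le_iSup₂ (f := fun x _ => J (H x)) x hx).trans hlt.le
  exact ⟨hx'.trans (EReal.coe_le_coe_iff.2 hMb), hJ _ hx'⟩

theorem proposition7p1 {N : ℕ} (hN : 3 ≤ N)
    (Ω : Set (EuclideanSpace ℝ (Fin N))) (hΩ : IsSmoothBoundedDomain Ω)
    (D : DirichletEigensystem Ω)
    (p q r : ℝ) (hp : 1 < p) (hq : 1 < q)
    (hr_lower : (N : ℝ) * (1 / 2 - 1 / (q + 1)) < r)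
    (hr_upper : r < 2 - (N : ℝ) * (1 / 2 - 1 / (p + 1)))
    (h k : Lp ℝ 2 (volume.restrict Ω))
    (χ : ℝ → ℝ) (hχ : IsCutoff χ) (A : ℝ) (hA : 0 < A)
    (J : ErSpace D r → EReal) (hJ : J = modifiedFunctional p q h k χ A)
    (R : ℕ → ℝ) (hR_pos : ∀ m, 0 < R m) (hR_mono : Monotone R)
    (hR : ∀ m, ∀ x ∈ XUpper D r m, R m < ‖x‖ → J x ≤ 0)
    (ν : ℕ → ℕ) (hν : StrictMono ν) (c d : ℕ → ℝ) (k₁ : ℕ)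
    (hc : ∀ m ≥ k₁, Tendsto (fun n => minimaxC R J m (ν n)) atTop (𝓝 (c m : EReal)))
    (hd : ∀ m ≥ k₁, Tendsto (fun n => minimaxD R J m (ν n)) atTop (𝓝 (d m : EReal)))
    (hcd : ∀ m ≥ k₁, c m = d m) :
    ∃ α₁ > (0 : ℝ), ∃ α₂ > (0 : ℝ), ∃ k₂ ≥ k₁, ∀ m ≥ k₂,
      c m ≤ α₁ * (m : ℝ) ^ ((q + 1) / q) + α₂ * (m : ℝ) ^ ((p + 1) / p) := by
  obtain ⟨θ, hθp, hθq, hθ, hθeq⟩ : ∃ θ : ℝ, 1 / (p + 1) ≤ θ ∧ 1 / (q + 1) ≤ θ ∧ θ ≤ 1 / 2 ∧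
      (1 / (1 - θ) = (q + 1) / q ∨ 1 / (1 - θ) = (p + 1) / p) := by
    have half : ∀ s : ℝ, 1 < s → 1 / (s + 1) ≤ 1 / 2 := fun s hs =>
      one_div_le_one_div_of_le (by norm_num) (by linarith)
    have dual : ∀ s : ℝ, 1 < s → 1 / (1 - 1 / (s + 1)) = (s + 1) / s := fun s hs => by
      have h1 : s + 1 ≠ 0 := by linarith
      have h2 : s ≠ 0 := by linarith
      have h3 : 1 - 1 / (s + 1) = s / (s + 1) := by field_simp; ring
      rw [h3, one_div_div]
    refine ⟨max (1 / (p + 1)) (1 / (q + 1)), le_max_left _ _, le_max_right _ _,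
      max_le (half p hp) (half q hq), ?_⟩
    rcases max_choice (1 / (p + 1)) (1 / (q + 1)) with hm | hm
    · exact Or.inr (by rw [hm, dual p hp])
    · exact Or.inl (by rw [hm, dual q hq])
  have hθ0 : 0 < θ := lt_of_lt_of_le (by positivity) hθp
  have : IsFiniteMeasure (volume.restrict Ω) :=
    isFiniteMeasure_restrict.2 hΩ.isBounded.measure_lt_top.ne
  obtain ⟨β, hβ, hdev⟩ := exists_modifiedFunctional_neg_le (D := D) (r := r) hp.le hq.le hθp hθq
    hθ h k hχ hA
  rw [← hJ] at hdev
  -- Truncation at `0` handles negative `c m`. With `M = max (c m) 0 + 1`, strictly above `d m`, the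
  -- deviation involves `M + 1 = max (c m) 0 + 2`; the extra `1` is absorbed since this base to the
  -- power `θ` is at least `1`.
  have hsucc : ∀ m ≥ max k₁ 1, max (c (m + 1)) 0 + 2 ≤
      max (c m) 0 + 2 + (β + 1) * (max (c m) 0 + 2) ^ θ := fun m hm => by
    have hm₁ : k₁ ≤ m := (le_max_left _ _).trans hm
    have hM : 0 ≤ max (c m) 0 := le_max_right _ _
    have hstep := minimaxC_limit_succ_le (M := max (c m) 0 + 1)
      (lt_of_le_of_lt (hcd m hm₁ ▸ le_max_left (c m) 0) (lt_add_one _))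
      (le_add_of_nonneg_right (by positivity)) (hdev (max (c m) 0 + 1) (by positivity))
      (hc (m + 1) (hm₁.trans m.le_succ)) (hd m hm₁)
    rw [add_assoc (max (c m) 0) 1 1, one_add_one_eq_two] at hstep
    have h1 : 1 ≤ (max (c m) 0 + 2) ^ θ := Real.one_le_rpow (by linarith) hθ0.le
    have h2 : 0 ≤ β * (max (c m) 0 + 2) ^ θ := by positivity
    have h3 : max (c (m + 1)) 0 ≤ max (c m) 0 + 1 + β * (max (c m) 0 + 2) ^ θ :=
      max_le hstep (by linarith)
    linarith
  obtain ⟨α, hα, hbound⟩ := exists_le_mul_rpow_of_succ_le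
    (a := fun m => max (c m) 0 + 2) hθ0 hθ (show 0 ≤ β + 1 by linarith)
    (le_max_right k₁ 1) (fun m => by positivity) hsucc
  -- One of the two powers already bounds `c m`; the other term is nonnegative.
  refine ⟨α, hα, α, hα, max k₁ 1, le_max_left _ _, fun m hm => ?_⟩
  have hcm : c m ≤ α * (m : ℝ) ^ (1 / (1 - θ)) := by
    linarith [hbound m hm, le_max_left (c m) 0]
  have h1 : 0 ≤ α * (m : ℝ) ^ ((q + 1) / q) := by positivity
  have h2 : 0 ≤ α * (m : ℝ) ^ ((p + 1) / p) := by positivity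
  rcases hθeq with e | e <;> rw [e] at hcm <;> linarith
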